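/- Let $K$ be a field of characteristic $0$, $R=K[x_1,\dots,x_n]$, and $I\subseteq R$ an ideal. **Local dual spaces.** Let $F$ be a field, $S=F[y_1,\dots,y_e]$, let $\mathfrak m\subset S$ be a maximal ideal and $\kappa(\mathfrak m)=S/\mathfrak m$. Let $\kappa(\mathfrak m)\langle\partial_y\rangle$ be the left $\kappa(\mathfrak m)$-vector space of finite sums $D=\sum_\alpha c_\alpha\partial_y^\alpha$, and put $D[f]:=\sum_\alpha c_\alpha\,(\partial_y^\alpha f \bmod \mathfrak m)\in\kappa(\mathfrak m)$ for $f\in S$. For an ideal $J\subseteq S$ put $$D_{\mathfrak m}[J]:=\{D\in\kappa(\mathfrak m)\langle\partial_y\rangle \mid D[f]=0 \text{ for all } f\in J\},\qquad E_{\mathfrak m}[J]:=D_{\mathfrak m}[J]\,/\,D_{\mathfrak m}[J:\mathfrak m^\infty],$$ where $J:\mathfrak m^\infty=\bigcup_k (J:\mathfrak m^k)$. **Data.** Suppose that for each $\mathfrak p\in\operatorname{Ass}(R/I)$ we are given 1. a regular system of parameters $t\sqcup y$ of $R$ (that is, $n$ elements of $R$ with $R=K[t,y]$ the polynomial ring in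 them) such that $t$ are free variables for $\mathfrak p$, i.e. the cosets of $t$ form a maximal algebraically independent family over $K$ in $R/\mathfrak p$; write $\mathfrak a(t):=K(t)\otimes_{K[t]}\mathfrak a$ for the extension of an ideal $\mathfrak a\subseteq R$ to $K(t)\otimes_{K[t]}R=K(t)[y]$, so that $\mathfrak p(t)$ is a maximal ideal; 2. a finite set $A_{\mathfrak p}\subseteq D_{\mathfrak p(t)}[I(t)]\subseteq\kappa(\mathfrak p(t))\langle\partial_y\rangle$ whose cosets span $E_{\mathfrak p(t)}[I(t)]$ over $\kappa(\mathfrak p(t))$. **Theorem.** The ideal $I$ can be recovered from $\operatorname{Ass}(R/I)$ and these data. Precisely: * (Determinacy) if $J\subseteq R$ is an ideal with $\operatorname{Ass}(R/J)=\operatorname{Ass}(R/I)$ such that, for every $\mathfrak p$ in this set, the same $A_{\mathfrak p}$ is contained in $D_{\mathfrak p(t)}[J(t)]$ and its cosets span $E_{\mathfrak p(t)}[J(t)]$, then $J=I$; * (Recovery of the localizations) for every $\mathfrak p\in\operatorname{Ass}(R/I)$ and $f\in R$, the image of $f$ in $R_{\mathfrak p}$ lies in $I_{\mathfrak p}=IR_{\mathfrak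 p}$ if and only if $D[f]=0$ in $\kappa(\mathfrak p'(t'))$ for all $\mathfrak p'\in\operatorname{Ass}(R/I)$ with $\mathfrak p'\subseteq\mathfrak p$ and all $D\in A_{\mathfrak p'}$, where $t'$ are the free variables given for $\mathfrak p'$; * (Recovery of $I$) $f\in R$ lies in $I$ if and only if $D[f]=0$ in $\kappa(\mathfrak p(t))$ for all $\mathfrak p\in\operatorname{Ass}(R/I)$ and all $D\in A_{\mathfrak p}$. -/

import Mathlib

namespace LocalDual

noncomputable section

open MvPolynomial

/-! ### Local dual spaces at a maximal ideal of a polynomial ring -/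

section LocalDualSpace

universe u v

variable {F : Type u} {τ : Type v} [Field F]

variable (F) in
/-- The partial derivative `∂ⱼ` on `F[y]`, as an `F`-linear endomorphism. -/
def partialEnd (j : τ) : Module.End F (MvPolynomial τ F) :=
  (pderiv (R := F) j).toLinearMap

theorem partialEnd_commute (i j : τ) : Commute (partialEnd F i) (partialEnd F j) := by
  classical
  have h : ⁅(pderiv i : Derivation F (MvPolynomial τ F) (MvPolynomial τ F)),
      (pderiv j : Derivation F (MvPolynomial τ F) (MvPolynomial τ F))⁆ = 0 := by
    apply MvPolynomial.derivation_ext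
    intro k
    simp only [Derivation.commutator_apply, pderiv_X, Derivation.coe_zero, Pi.zero_apply]
    by_cases h1 : k = j <;> by_cases h2 : k = i <;>
      simp [Pi.single_apply, h1, h2, apply_ite]
  refine LinearMap.ext fun f => ?_
  have h' := congrArg (fun D : Derivation F (MvPolynomial τ F) (MvPolynomial τ F) => D f) h
  simp only [Derivation.commutator_apply, Derivation.coe_zero, Pi.zero_apply] at h'
  exact sub_eq_zero.mp h'

theorem partialEnd_pairwise (α : τ →₀ ℕ) :
    (α.support : Set τ).Pairwise (Function.onFun Commute fun j => partialEnd F j ^ α j) :=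
  fun i _ j _ _ => (partialEnd_commute i j).pow_pow (α i) (α j)

/-- The iterated partial derivative `∂^α = ∏ⱼ ∂ⱼ ^ αⱼ` on `F[y]`. -/
def partialPow (α : τ →₀ ℕ) : Module.End F (MvPolynomial τ F) :=
  α.support.noncommProd (fun j => partialEnd F j ^ α j)
    (partialEnd_pairwise α)

/-- The local differential space `κ(m)⟨∂_y⟩ = κ(m) ⊗ W` at `m`, as a left vector space over
`κ(m) = F[y] ⧸ m`: finite sums `∑ c_α ∂^α` with `c_α ∈ κ(m)`. -/
abbrev DiffOp (m : Ideal (MvPolynomial τ F)) : Type (max u v) :=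
  (τ →₀ ℕ) →₀ (MvPolynomial τ F ⧸ m)

/-- The value at `m` of an operator applied to `f`, that is, `∑ c_α ∂^α ↦ ∑ c_α (∂^α f mod m)`,
as a `κ(m)`-linear function of the operator. -/
def evalAt (m : Ideal (MvPolynomial τ F)) (f : MvPolynomial τ F) :
    DiffOp m →ₗ[(MvPolynomial τ F ⧸ m)] (MvPolynomial τ F ⧸ m) :=
  Finsupp.linearCombination (MvPolynomial τ F ⧸ m)
    (fun α => Ideal.Quotient.mk m (partialPow α f))

/-- The local dual space `D_m[I]`. -/
def localDual (m I : Ideal (MvPolynomial τ F)) : Submodule (MvPolynomial τ F ⧸ m) (DiffOp m) where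
  carrier := {D | ∀ f ∈ I, evalAt m f D = 0}
  add_mem' := fun hD hE f hf => by rw [map_add, hD f hf, hE f hf, add_zero]
  zero_mem' := fun _ _ => map_zero _
  smul_mem' := fun c D hD f hf => by rw [map_smul, hD f hf, smul_zero]

/-- The saturation `I : m^∞ = ⋃ₖ (I : m^k)`. -/
def saturation (I m : Ideal (MvPolynomial τ F)) : Ideal (MvPolynomial τ F) :=
  ⨆ k : ℕ, Submodule.colon I ((m ^ k : Ideal (MvPolynomial τ F)) : Set (MvPolynomial τ F))

theorem le_saturation (I m : Ideal (MvPolynomial τ F)) : I ≤ saturation I m := by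
  refine le_iSup_of_le 0 fun f hf => ?_
  rw [Submodule.mem_colon]
  exact fun g _ => I.mul_mem_right g hf

theorem localDual_saturation_le (m I : Ideal (MvPolynomial τ F)) :
    localDual m (saturation I m) ≤ localDual m I :=
  fun _ hD f hf => hD f (le_saturation I m hf)

/-- The excess dual space `E_m[I] = D_m[I] / D_m[I : m^∞]`, as a subspace of the quotient of the
local differential space by `D_m[I : m^∞]` (note that `D_m[I : m^∞] ⊆ D_m[I]`). -/
def excessDual (m I : Ideal (MvPolynomial τ F)) :
    Submodule (MvPolynomial τ F ⧸ m) (DiffOp m ⧸ localDual m (saturation I m)) :=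
  (localDual m I).map (localDual m (saturation I m)).mkQ

/-- `A ⊆ D_m[I]`, and the cosets of the elements of `A` span `E_m[I]` over `κ(m)`. -/
def SpansExcess (m I : Ideal (MvPolynomial τ F)) (A : Set (DiffOp m)) : Prop :=
  A ⊆ localDual m I ∧
    Submodule.span (MvPolynomial τ F ⧸ m) ((localDual m (saturation I m)).mkQ '' A) = excessDual m I

end LocalDualSpace

/-! ### Reduction to dimension zero -/

section Reduction

variable {K : Type*} [Field K] {n : ℕ}

variable (K n) in
/-- A (regular) system of parameters of `R = K[x₁, …, xₙ]`: elements `z₁, …, zₙ` such that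
`R` is the polynomial ring `K[z₁, …, zₙ]`. -/
structure ParameterSystem where
  param : Fin n → MvPolynomial (Fin n) K
  bijective_aeval : Function.Bijective
    (aeval param : MvPolynomial (Fin n) K →ₐ[K] MvPolynomial (Fin n) K)

/-- Polynomials in the parameters, as polynomials in the variables. -/
def ParameterSystem.equiv (z : ParameterSystem K n) :
    MvPolynomial (Fin n) K ≃ₐ[K] MvPolynomial (Fin n) K :=
  AlgEquiv.ofBijective (aeval z.param) z.bijective_aeval

variable (K) in
/-- The field `K(t)` of rational functions in the parameters with index in `T`. -/
def RatField (T : Finset (Fin n)) : Type _ :=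
  FractionRing (MvPolynomial {i // i ∈ T} K)

instance (T : Finset (Fin n)) : Field (RatField K T) :=
  inferInstanceAs (Field (FractionRing (MvPolynomial {i // i ∈ T} K)))

instance (T : Finset (Fin n)) : Algebra (MvPolynomial {i // i ∈ T} K) (RatField K T) :=
  inferInstanceAs (Algebra _ (FractionRing (MvPolynomial {i // i ∈ T} K)))

instance (T : Finset (Fin n)) : IsFractionRing (MvPolynomial {i // i ∈ T} K) (RatField K T) :=
  inferInstanceAs (IsFractionRing _ (FractionRing (MvPolynomial {i // i ∈ T} K)))

instance (T : Finset (Fin n)) : Algebra K (RatField K T) :=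
  inferInstanceAs (Algebra K (FractionRing (MvPolynomial {i // i ∈ T} K)))

instance (T : Finset (Fin n)) :
    IsScalarTower K (MvPolynomial {i // i ∈ T} K) (RatField K T) :=
  inferInstanceAs (IsScalarTower K (MvPolynomial {i // i ∈ T} K)
    (FractionRing (MvPolynomial {i // i ∈ T} K)))

variable (K) in
/-- The ring `K(t) ⊗_{K[t]} R = K(t)[y]`, where `t` are the parameters with index in `T` and
`y` the remaining ones. -/
abbrev RatRing (T : Finset (Fin n)) : Type _ :=
  MvPolynomial {j // j ∉ T} (RatField K T)

/-- The inclusion `R = K[t, y] → K(t)[y]`. -/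
def toRat (z : ParameterSystem K n) (T : Finset (Fin n)) :
    MvPolynomial (Fin n) K →ₐ[K] RatRing K T :=
  (aeval fun j => if h : j ∈ T
      then C (algebraMap (MvPolynomial {i // i ∈ T} K) (RatField K T) (X ⟨j, h⟩))
      else X ⟨j, h⟩).comp
    (z.equiv.symm : MvPolynomial (Fin n) K →ₐ[K] MvPolynomial (Fin n) K)

theorem toRat_param (z : ParameterSystem K n) (T : Finset (Fin n)) (j : Fin n) :
    toRat z T (z.param j) = if h : j ∈ T
      then C (algebraMap (MvPolynomial {i // i ∈ T} K) (RatField K T) (X ⟨j, h⟩))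
      else X ⟨j, h⟩ := by
  have h : z.equiv.symm (z.param j) = X j := by
    rw [AlgEquiv.symm_apply_eq]
    simp [ParameterSystem.equiv]
  simp [toRat, h]

/-- The extension `K(t) ⊗ I` of an ideal `I` of `R` to `K(t)[y]`. -/
def extend (z : ParameterSystem K n) (T : Finset (Fin n)) (I : Ideal (MvPolynomial (Fin n) K)) :
    Ideal (RatRing K T) :=
  I.map (toRat z T)

/-- The data attached to a prime `p`: a system of parameters `t ⊔ y` of `R` such that `t` are free
variables for `p` (their cosets are a maximal algebraically independent family in `R ⧸ p`), and a
finite set of differential operators in `κ(K(t) ⊗ p)⟨∂_y⟩`. -/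
structure PrimeData (p : Ideal (MvPolynomial (Fin n) K)) where
  /-- The parameters `t ⊔ y`. -/
  z : ParameterSystem K n
  /-- The indices of the parameters `t`. -/
  T : Finset (Fin n)
  free : IsTranscendenceBasis K (fun i : {i // i ∈ T} => Ideal.Quotient.mk p (z.param i))
  ops : Set (DiffOp (extend z T p))
  finite_ops : ops.Finite

/-- The operators lie in `D_{K(t) ⊗ p}[K(t) ⊗ I]` and their cosets span
`E_{K(t) ⊗ p}[K(t) ⊗ I]`. -/
def PrimeData.Describes {p : Ideal (MvPolynomial (Fin n) K)} (d : PrimeData p)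
    (I : Ideal (MvPolynomial (Fin n) K)) : Prop :=
  SpansExcess (extend d.z d.T p) (extend d.z d.T I) d.ops

/-- All operators of the data, applied to `f ∈ R`, vanish in `κ(K(t) ⊗ p)`. -/
def PrimeData.Annihilates {p : Ideal (MvPolynomial (Fin n) K)} (d : PrimeData p)
    (f : MvPolynomial (Fin n) K) : Prop :=
  ∀ D ∈ d.ops, evalAt (extend d.z d.T p) (toRat d.z d.T f) D = 0

/-- The set `Ass(R/I)`. -/
abbrev Ass (I : Ideal (MvPolynomial (Fin n) K)) : Set (Ideal (MvPolynomial (Fin n) K)) :=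
  associatedPrimes (MvPolynomial (Fin n) K) (MvPolynomial (Fin n) K ⧸ I)

instance Ass.isPrime {I : Ideal (MvPolynomial (Fin n) K)} (p : Ass I) :
    (p : Ideal (MvPolynomial (Fin n) K)).IsPrime :=
  IsAssociatedPrime.isPrime p.2

/-- The localization `I_p = I R_p`. -/
abbrev localize (I p : Ideal (MvPolynomial (Fin n) K)) [p.IsPrime] :
    Ideal (Localization.AtPrime p) :=
  I.map (algebraMap (MvPolynomial (Fin n) K) (Localization.AtPrime p))

end Reduction

end

end LocalDual

/-! Membership in `I` is local at the associated primes, so it suffices to decide when `f` lies in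
`I_p`, by induction on `p`. If `f ∈ I_q` for every associated `q < p`, then near `p` the ideal `(I :
f)` contains a power of `p` (`exists_mul_pow_mem_of_forall_lt`). After extension to `K(t)[y]`, `f`
therefore lies locally in the saturation, and every operator in its dual space kills `f`. Operators
spanning the excess dual then test `f` against all of `D[I(t)]`.

What remains is duality at a maximal ideal `m` (`exists_mul_mem_of_forall_evalAt_eq_zero`): if
`D_m[J]` kills `f`, then `f ∈ J` locally at `m`. In characteristic `0`, operators are exactly the
functionals on truncated Taylor expansions, so `f` lies in `J + (y)^k` for all `k` after translation
to a `κ(m)`-point; Krull's intersection theorem and descent from `κ(m)` to `F` conclude. Since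
`p(t)` is maximal and denominators from `K[t]` avoid `p`, this pulls back to `R`. -/

namespace LocalDual

open MvPolynomial

/-! ### Taylor expansion at a point and iterated derivatives -/

section Taylor

variable {F κ τ : Type*} [Field F] [Field κ] [Algebra F κ]

/-- The Taylor expansion at the `κ`-point `a`: the homomorphism `f(y) ↦ f(y + a)`. -/
noncomputable def taylorHom (a : τ → κ) : MvPolynomial τ F →ₐ[F] MvPolynomial τ κ :=
  aeval fun i => X i + C (a i)

theorem constantCoeff_taylorHom (a : τ → κ) (f : MvPolynomial τ F) :
    constantCoeff (taylorHom a f) = aeval a f := by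
  induction f using MvPolynomial.induction_on with
  | C r => simp [taylorHom, algebraMap_eq, IsScalarTower.algebraMap_apply F κ (MvPolynomial τ κ)]
  | add p q hp hq => simp [hp, hq]
  | mul_X p i hp => rw [map_mul, map_mul, hp]; simp [taylorHom]

theorem taylorHom_pderiv (a : τ → κ) (j : τ) (f : MvPolynomial τ F) :
    taylorHom a (pderiv j f) = pderiv j (taylorHom a f) := by
  classical
  induction f using MvPolynomial.induction_on with
  | C r => simp [taylorHom, algebraMap_eq, IsScalarTower.algebraMap_apply F κ (MvPolynomial τ κ)]
  | add p q hp hq => simp [hp, hq]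
  | mul_X p i hp =>
    simp only [Derivation.leibniz, map_add, smul_eq_mul, map_mul, hp]
    have h1 : taylorHom (F := F) a (X i) = X i + C (a i) := by simp [taylorHom]
    have h2 : taylorHom (F := F) a (pderiv j (X i)) = pderiv j (X i + C (a i)) := by
      by_cases h : j = i <;> simp [pderiv_X, h, eq_comm]
    rw [h1, h2]

/-- The product `β! = ∏ βᵢ!`. -/
def multiFactorial (β : τ →₀ ℕ) : ℕ := β.prod fun _ k => k.factorial

theorem multiFactorial_ne_zero (β : τ →₀ ℕ) : multiFactorial β ≠ 0 :=
  Finset.prod_ne_zero_iff.mpr fun _ _ => Nat.factorial_ne_zero _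

theorem multiFactorial_add_single (β : τ →₀ ℕ) (j : τ) :
    multiFactorial (β + Finsupp.single j 1) = (β j + 1) * multiFactorial β := by
  classical
  have key : ∀ s : Finset τ, β.support ⊆ s →
      multiFactorial β = ∏ i ∈ s, (β i).factorial := fun s hs =>
    Finsupp.prod_of_support_subset _ hs _ (by simp)
  rw [multiFactorial, Finsupp.prod_of_support_subset _ (s := insert j β.support) _ _ (by simp),
    key (insert j β.support) (Finset.subset_insert _ _),
    ← Finset.mul_prod_erase _ _ (Finset.mem_insert_self j _),
    ← Finset.mul_prod_erase _ (fun i => (β i).factorial) (Finset.mem_insert_self j _), ← mul_assoc]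
  · congr 1
    · simp [Nat.factorial_succ]
    · refine Finset.prod_congr rfl fun i hi => ?_
      simp [(Finset.ne_of_mem_erase hi).symm]
  · intro i hi
    have := Finsupp.support_add hi
    rw [Finset.mem_union] at this
    rcases this with h | h
    · exact Finset.mem_insert_of_mem h
    · have := Finsupp.support_single_subset h
      simp_all

/-- The coefficient of `y^β` in the Taylor expansion of `f` at `a`, multiplied by `β!`. -/
noncomputable def taylorCoeff (a : τ → κ) (β : τ →₀ ℕ) (f : MvPolynomial τ F) : κ :=
  multiFactorial β * coeff β (taylorHom a f)

theorem taylorCoeff_zero (a : τ → κ) (f : MvPolynomial τ F) :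
    taylorCoeff a 0 f = aeval a f := by
  rw [← constantCoeff_taylorHom]
  simp [taylorCoeff, multiFactorial, constantCoeff_eq]

/-- The normalisation by `β!` absorbs the exponent produced by differentiation, leaving a pure shift
of the index. -/
theorem taylorCoeff_partialEnd (a : τ → κ) (β : τ →₀ ℕ) (j : τ) (f : MvPolynomial τ F) :
    taylorCoeff a β (partialEnd F j f) = taylorCoeff a (β + Finsupp.single j 1) f := by
  have : partialEnd F j f = pderiv j f := rfl
  rw [taylorCoeff, taylorCoeff, this, taylorHom_pderiv, coeff_pderiv, multiFactorial_add_single]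
  push_cast
  ring

theorem taylorCoeff_partialEnd_pow (a : τ → κ) (β : τ →₀ ℕ) (j : τ) (k : ℕ)
    (f : MvPolynomial τ F) :
    taylorCoeff a β ((partialEnd F j ^ k) f) = taylorCoeff a (β + Finsupp.single j k) f := by
  induction k generalizing β with
  | zero => simp
  | succ k ih =>
    rw [pow_succ', Module.End.mul_apply, taylorCoeff_partialEnd, ih, add_assoc, ← Finsupp.single_add,
      add_comm 1 k]

theorem taylorCoeff_partialPow (a : τ → κ) (α β : τ →₀ ℕ) (f : MvPolynomial τ F) :
    taylorCoeff a β (partialPow α f) = taylorCoeff a (β + α) f := by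
  classical
  induction α using Finsupp.induction generalizing β with
  | zero =>
    have h : partialPow (F := F) (0 : τ →₀ ℕ) = 1 :=
      (Finset.noncommProd_congr Finsupp.support_zero (fun _ _ => rfl) _).trans
        (Finset.noncommProd_empty _ _)
    rw [h, add_zero, Module.End.one_apply]
  | single_add j b α hj hb ih =>
    have h : partialPow (F := F) (Finsupp.single j b + α) = partialEnd F j ^ b * partialPow α := by
      have hs : (Finsupp.single j b + α).support = insert j α.support := by
        rw [Finsupp.support_add_eq, Finsupp.support_single _ hb, Finset.insert_eq]
        rw [Finsupp.support_single _ hb]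
        simpa using hj
      have e : partialPow (F := F) (Finsupp.single j b + α) =
          (insert j α.support).noncommProd
            (fun i => partialEnd F i ^ (Finsupp.single j b + α : τ →₀ ℕ) i)
            (hs ▸ partialEnd_pairwise _) :=
        Finset.noncommProd_congr hs (fun _ _ => rfl) _
      rw [e, Finset.noncommProd_insert_of_notMem _ _ _ _ hj]
      congr 1
      · simp [Finsupp.notMem_support_iff.mp hj]
      · refine Finset.noncommProd_congr rfl (fun i hi => ?_) _
        have : j ≠ i := fun h => hj (h ▸ hi)
        simp [this]
    rw [h, Module.End.mul_apply, taylorCoeff_partialEnd_pow, ih, add_assoc]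

theorem aeval_partialPow (a : τ → κ) (α : τ →₀ ℕ) (f : MvPolynomial τ F) :
    aeval a (partialPow α f) = multiFactorial α * coeff α (taylorHom a f) := by
  rw [← taylorCoeff_zero, taylorCoeff_partialPow, zero_add, taylorCoeff]

/-- The constant term of the expansion is the value at `a`, so the kernel of evaluation is carried
into the ideal of the variables; take powers. -/
theorem taylorHom_mem_pow_idealOfVars (a : τ → κ) {k : ℕ} {f : MvPolynomial τ F}
    (hf : f ∈ RingHom.ker (aeval a : MvPolynomial τ F →ₐ[F] κ) ^ k) :
    taylorHom a f ∈ idealOfVars τ κ ^ k := by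
  have h : (RingHom.ker (aeval a : MvPolynomial τ F →ₐ[F] κ)).map (taylorHom (F := F) a) ≤
      idealOfVars τ κ := by
    rw [Ideal.map_le_iff_le_comap]
    intro g hg
    rw [Ideal.mem_comap, ← pow_one (idealOfVars τ κ), mem_pow_idealOfVars_iff']
    intro x hx
    have : x = 0 := by rwa [Nat.lt_one_iff, Finsupp.degree_eq_zero_iff] at hx
    rw [this, ← constantCoeff_eq, constantCoeff_taylorHom]
    exact hg
  exact Ideal.pow_right_mono h k (Ideal.map_pow (taylorHom (F := F) a) _ k ▸
    Ideal.mem_map_of_mem _ hf)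

end Taylor

/-! ### Descent of ideal membership from `κ` to `F` -/

section Descent

variable {F κ τ : Type*} [Field F] [Field κ] [Algebra F κ]

/-- Application of an `F`-linear map `φ : κ → F` to the coefficients of a polynomial. -/
noncomputable def mapCoeff (φ : κ →ₗ[F] F) (g : MvPolynomial τ κ) : MvPolynomial τ F :=
  ∑ α ∈ g.support, monomial α (φ (coeff α g))

theorem coeff_mapCoeff (φ : κ →ₗ[F] F) (g : MvPolynomial τ κ) (α : τ →₀ ℕ) :
    coeff α (mapCoeff φ g) = φ (coeff α g) := by
  classical
  simp +contextual [mapCoeff, coeff_sum, coeff_monomial]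

theorem mapCoeff_add (φ : κ →ₗ[F] F) (g h : MvPolynomial τ κ) :
    mapCoeff φ (g + h) = mapCoeff φ g + mapCoeff φ h := by
  ext α; simp [coeff_mapCoeff]

theorem mapCoeff_mul_map (φ : κ →ₗ[F] F) (g : MvPolynomial τ κ) (f : MvPolynomial τ F) :
    mapCoeff φ (g * map (algebraMap F κ) f) = mapCoeff φ g * f := by
  classical
  ext α
  simp only [coeff_mapCoeff, coeff_mul, coeff_map, map_sum]
  refine Finset.sum_congr rfl fun x _ => ?_
  rw [mul_comm, ← Algebra.smul_def, map_smul, smul_eq_mul, mul_comm]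

theorem mapCoeff_mem (φ : κ →ₗ[F] F) {J : Ideal (MvPolynomial τ F)} {g : MvPolynomial τ κ}
    (hg : g ∈ J.map (map (algebraMap F κ))) : mapCoeff φ g ∈ J := by
  -- `mapCoeff φ` is only `F[y]`-linear, so the induction must carry an arbitrary multiplier `h`
  -- over `κ`; at the end `h = 1`.
  refine Submodule.span_induction (p := fun g _ => ∀ h, mapCoeff φ (h * g) ∈ J) ?_ ?_ ?_ ?_ hg 1
    |> fun h => by simpa using h
  · rintro _ ⟨f, hf, rfl⟩ h
    rw [mapCoeff_mul_map]
    exact J.mul_mem_left _ hf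
  · intro h
    simp [mapCoeff]
  · intro x y _ _ hx hy h
    rw [mul_add, mapCoeff_add]
    exact J.add_mem (hx h) (hy h)
  · intro r x _ hx h
    rw [smul_eq_mul, ← mul_assoc]
    exact hx _

/-- In an `F`-basis `b` of `κ`, `g` is the sum of the `b i` times its coordinate polynomials over
`F`. If these all vanished at `a`, so would `g`. -/
theorem exists_aeval_mapCoeff_ne_zero [Module.Finite F κ] (a : τ → κ) {g : MvPolynomial τ κ}
    (hg : eval a g ≠ 0) : ∃ φ : κ →ₗ[F] F, aeval a (mapCoeff φ g) ≠ 0 := by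
  by_contra! h
  apply hg
  let b := Module.finBasis F κ
  have : g = ∑ i, C (b i) * map (algebraMap F κ) (mapCoeff (b.coord i) g) := by
    ext α
    rw [coeff_sum]
    simp only [coeff_C_mul, coeff_map, coeff_mapCoeff, b.coord_apply]
    conv_lhs => rw [← b.sum_repr (coeff α g)]
    exact Finset.sum_congr rfl fun i _ => by rw [Algebra.smul_def, mul_comm]
  rw [this, map_sum]
  refine Finset.sum_eq_zero fun i _ => ?_
  rw [map_mul, eval_map, ← aeval_def, h, mul_zero]

theorem exists_mul_mem_of_mul_taylorHom_mem [Module.Finite F κ] (a : τ → κ)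
    {J : Ideal (MvPolynomial τ F)} {f : MvPolynomial τ F} {g : MvPolynomial τ κ}
    (hg : constantCoeff g ≠ 0) (h : g * taylorHom a f ∈ J.map (taylorHom (F := F) a)) :
    ∃ s : MvPolynomial τ F, aeval a s ≠ 0 ∧ s * f ∈ J := by
  -- Translation by `-a` undoes the Taylor shift, leaving only the base change from `F` to `κ`, to
  -- which `mapCoeff` applies.
  let σ : MvPolynomial τ κ →ₐ[κ] MvPolynomial τ κ := aeval fun i => X i - C (a i)
  have hσ : (σ : MvPolynomial τ κ →+* MvPolynomial τ κ).comp
      (taylorHom (F := F) a : MvPolynomial τ F →+* MvPolynomial τ κ) = map (algebraMap F κ) := by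
    apply MvPolynomial.ringHom_ext
    · intro r
      simp [taylorHom, algebraMap_eq, IsScalarTower.algebraMap_apply F κ (MvPolynomial τ κ), σ]
    · intro i
      simp [taylorHom, σ]
  have hσ' (f : MvPolynomial τ F) : σ (taylorHom a f) = map (algebraMap F κ) f :=
    RingHom.congr_fun hσ f
  have hc : (eval a).comp (σ : MvPolynomial τ κ →+* MvPolynomial τ κ) = constantCoeff := by
    apply MvPolynomial.ringHom_ext <;> simp [σ, algebraMap_eq]
  have he : eval a (σ g) = constantCoeff g := RingHom.congr_fun hc g
  have hm := Ideal.mem_map_of_mem (σ : MvPolynomial τ κ →+* MvPolynomial τ κ) h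
  have hJ : (J.map (taylorHom (F := F) a)).map (σ : MvPolynomial τ κ →+* MvPolynomial τ κ) =
      J.map (map (algebraMap F κ)) := by
    rw [← hσ, ← Ideal.map_map]; rfl
  rw [hJ, RingHom.map_mul] at hm
  obtain ⟨φ, hφ⟩ := exists_aeval_mapCoeff_ne_zero (F := F) a (he ▸ hg)
  refine ⟨_, hφ, ?_⟩
  rw [← mapCoeff_mul_map, ← hσ']
  exact mapCoeff_mem φ hm

end Descent

/-! ### Duality at a `κ`-point -/

section Duality

variable {F κ τ : Type*} [Field F] [Field κ] [Algebra F κ]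

theorem exists_mul_mem_of_forall_sum_eq_zero [Finite τ] [CharZero F] [Module.Finite F κ]
    (a : τ → κ) {J : Ideal (MvPolynomial τ F)} {f : MvPolynomial τ F}
    (h : ∀ D : (τ →₀ ℕ) →₀ κ, (∀ g ∈ J, (D.sum fun α c => c * aeval a (partialPow α g)) = 0) →
      (D.sum fun α c => c * aeval a (partialPow α f)) = 0) :
    ∃ s : MvPolynomial τ F, aeval a s ≠ 0 ∧ s * f ∈ J := by
  classical
  have : CharZero κ := charZero_of_injective_algebraMap (algebraMap F κ).injective
  set J' := J.map (taylorHom (F := F) a)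
  have hk : ∀ k : ℕ, taylorHom a f ∈ J' ⊔ idealOfVars τ κ ^ k := by
    intro k
    by_contra hf
    -- A `κ`-linear functional vanishing on `J' + (y)^k` but not on the expansion of `f` will be
    -- realised by a differential operator.
    obtain ⟨φ, hφ, hφJ⟩ := Submodule.exists_le_ker_of_notMem
      (p := (J' ⊔ idealOfVars τ κ ^ k).restrictScalars κ) hf
    have hfin : {α : τ →₀ ℕ | α.degree < k}.Finite := Finsupp.finite_of_degree_lt k
    -- Since `∂^α` at `a` returns `α!` times the Taylor coefficient, `φ` is represented by the
    -- weights `φ(y^α) / α!`. As `φ` kills `(y)^k`, only degrees below `k` occur.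
    let D : (τ →₀ ℕ) →₀ κ := Finsupp.onFinset hfin.toFinset
      (fun α => if α.degree < k then φ (monomial α 1) * (multiFactorial α : κ)⁻¹ else 0)
      (fun α hα => by simpa using (ite_ne_right_iff.mp hα).1)
    have hD : ∀ g : MvPolynomial τ F,
        (D.sum fun α c => c * aeval a (partialPow α g)) = φ (taylorHom a g) := by
      intro g
      have h1 : taylorHom a g - ∑ α ∈ hfin.toFinset, monomial α (coeff α (taylorHom a g)) ∈
          idealOfVars τ κ ^ k := by
        rw [mem_pow_idealOfVars_iff']
        intro x hx
        rw [coeff_sub, coeff_sum]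
        simp [coeff_monomial, hx]
      have h2 := hφJ ((le_sup_right : _ ≤ J' ⊔ idealOfVars τ κ ^ k) h1)
      rw [LinearMap.mem_ker, map_sub, sub_eq_zero] at h2
      rw [h2, map_sum, Finsupp.onFinset_sum _ (by simp)]
      refine Finset.sum_congr rfl fun α hα => ?_
      have hα' : α.degree < k := by simpa using hα
      have h3 : monomial α (coeff α (taylorHom a g)) =
          coeff α (taylorHom a g) • (monomial α (1 : κ)) := by simp [smul_monomial]
      have h4 : (multiFactorial α : κ) ≠ 0 := Nat.cast_ne_zero.mpr (multiFactorial_ne_zero α)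
      rw [if_pos hα', h3, map_smul, aeval_partialPow, smul_eq_mul]
      field_simp
    refine hφ ?_
    rw [← hD]
    exact h D fun g hg => (hD g).trans (hφJ
      ((le_sup_left : _ ≤ J' ⊔ idealOfVars τ κ ^ k) (Ideal.mem_map_of_mem _ hg)))
  have hmem : (Ideal.Quotient.mk J' (taylorHom a f)) ∈
      (⨅ k : ℕ, idealOfVars τ κ ^ k • ⊤ : Submodule (MvPolynomial τ κ) (MvPolynomial τ κ ⧸ J')) := by
    rw [Submodule.mem_iInf]
    intro k
    obtain ⟨u, hu, v, hv, huv⟩ := Submodule.mem_sup.mp (hk k)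
    rw [← huv, map_add, Ideal.Quotient.eq_zero_iff_mem.mpr hu, zero_add]
    have : Ideal.Quotient.mk J' v = v • Ideal.Quotient.mk J' 1 := by
      rw [← smul_eq_mul v 1 |>.trans (mul_one v) |> congrArg (Ideal.Quotient.mk J')]
      rfl
    rw [this]
    exact Submodule.smul_mem_smul hv trivial
  -- Krull's intersection theorem: some `r ∈ (y)` fixes the class of the expansion modulo `J'`, so
  -- `1 - r`, with constant term `1`, multiplies the expansion into `J'`.
  rw [Ideal.mem_iInf_smul_pow_eq_bot_iff] at hmem
  obtain ⟨⟨r, hr⟩, hr'⟩ := hmem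
  refine exists_mul_mem_of_mul_taylorHom_mem a (g := 1 - r) ?_ ?_
  · have : constantCoeff r = 0 := by
      rw [← pow_one (idealOfVars τ κ), mem_pow_idealOfVars_iff'] at hr
      exact hr 0 (by simp)
    simp [this]
  · rw [sub_mul, one_mul, ← Ideal.Quotient.eq_zero_iff_mem, map_sub, sub_eq_zero]
    exact hr'.symm

end Duality

/-! ### Dual spaces at a maximal ideal -/

section Maximal

universe u v

variable {F : Type u} {τ : Type v} [Field F] {m J : Ideal (MvPolynomial τ F)}
  {f : MvPolynomial τ F}

theorem evalAt_apply (f : MvPolynomial τ F) (D : DiffOp m) :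
    evalAt m f D = D.sum fun α c => c * Ideal.Quotient.mk m (partialPow α f) := rfl

theorem aeval_mk_X (g : MvPolynomial τ F) :
    aeval (fun i => Ideal.Quotient.mk m (X i)) g = Ideal.Quotient.mk m g := by
  have : aeval (fun i => Ideal.Quotient.mk m (X i)) = Ideal.Quotient.mkₐ F m := by
    apply MvPolynomial.algHom_ext
    intro i
    simp
  exact DFunLike.congr_fun this g

/-- By the Nullstellensatz `F[y] ⧸ m` is finite over `F`, so point duality applies to the
tautological point given by the cosets of the variables. -/
theorem exists_mul_mem_of_forall_evalAt_eq_zero [Finite τ] [CharZero F] [hm : m.IsMaximal]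
    (h : ∀ D ∈ localDual m J, evalAt m f D = 0) : ∃ s, s ∉ m ∧ s * f ∈ J := by
  let _ := Ideal.Quotient.field m
  have hfin : Module.Finite F (MvPolynomial τ F ⧸ m) :=
    finite_of_finite_type_of_isJacobsonRing F (MvPolynomial τ F ⧸ m)
  have ha := aeval_mk_X (m := m)
  obtain ⟨s, hs, hsf⟩ := exists_mul_mem_of_forall_sum_eq_zero (J := J) (f := f)
    (fun i => Ideal.Quotient.mk m (X i)) fun D hD => by
      simp only [ha] at hD ⊢
      exact h D hD
  refine ⟨s, fun hsm => hs ?_, hsf⟩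
  rw [ha, Ideal.Quotient.eq_zero_iff_mem.mpr hsm]

theorem exists_forall_mem_pow_evalAt_eq_zero [hm : m.IsMaximal] (D : DiffOp m) :
    ∃ k, ∀ g ∈ m ^ k, evalAt m g D = 0 := by
  let _ := Ideal.Quotient.field m
  have ha := aeval_mk_X (m := m)
  have hker : RingHom.ker (aeval (fun i => Ideal.Quotient.mk m (X i)) :
      MvPolynomial τ F →ₐ[F] MvPolynomial τ F ⧸ m) = m := by
    ext g
    rw [RingHom.mem_ker, ha, Ideal.Quotient.eq_zero_iff_mem]
  -- One more than the order of `D`: expansions of elements of `m ^ k` start in degree `k`, beyond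
  -- every exponent of `D`.
  refine ⟨D.support.sup Finsupp.degree + 1, fun g hg => ?_⟩
  rw [evalAt_apply]
  refine Finset.sum_eq_zero fun α hα => ?_
  have h := taylorHom_mem_pow_idealOfVars (fun i => Ideal.Quotient.mk m (X i)) (f := g)
    (k := D.support.sup Finsupp.degree + 1) (by rwa [hker])
  rw [mem_pow_idealOfVars_iff'] at h
  have h1 := aeval_partialPow (fun i => Ideal.Quotient.mk m (X i)) α g
  rw [h α (Nat.lt_succ_of_le (Finset.le_sup hα)), mul_zero, ha] at h1
  exact (congrArg (D α * ·) h1).trans (mul_zero _)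

/-- Some power `m ^ k` is killed by `D`, and `s` is invertible modulo it: `c * s + v = 1` with `v ∈
m ^ k` splits `f` into an element of `J` and one of `m ^ k`. -/
theorem evalAt_eq_zero_of_mul_mem [hm : m.IsMaximal] {s : MvPolynomial τ F} (hs : s ∉ m)
    (hsf : s * f ∈ J) {D : DiffOp m} (hD : D ∈ localDual m J) : evalAt m f D = 0 := by
  obtain ⟨k, hk⟩ := exists_forall_mem_pow_evalAt_eq_zero D
  have hcop : Ideal.span {s} ⊔ m ^ k = ⊤ := by
    apply Ideal.sup_pow_eq_top
    rw [sup_comm]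
    refine hm.1.2 _ (lt_of_le_of_ne le_sup_left fun h => hs ?_)
    rw [h]
    exact Ideal.mem_sup_right (Ideal.mem_span_singleton_self s)
  obtain ⟨u, hu, v, hv, huv⟩ := Submodule.mem_sup.mp ((Ideal.eq_top_iff_one _).mp hcop)
  obtain ⟨c, rfl⟩ := Ideal.mem_span_singleton'.mp hu
  have hadd : ∀ g h : MvPolynomial τ F, evalAt m (g + h) D = evalAt m g D + evalAt m h D := by
    intro g h
    simp only [evalAt_apply, map_add, mul_add, Finsupp.sum_add]
  have : f = c * (s * f) + v * f := by
    rw [← mul_assoc, ← add_mul, huv, one_mul]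
  rw [this, hadd, hD _ (J.mul_mem_left c hsf), hk _ (Ideal.mul_mem_right f _ hv), add_zero]

theorem SpansExcess.evalAt_eq_zero {A : Set (DiffOp m)} (hA : SpansExcess m J A)
    (hf : ∀ D ∈ A, evalAt m f D = 0) (hs : ∀ D ∈ localDual m (saturation J m), evalAt m f D = 0)
    {D : DiffOp m} (hD : D ∈ localDual m J) : evalAt m f D = 0 := by
  have h1 : (localDual m (saturation J m)).mkQ D ∈ excessDual m J := Submodule.mem_map_of_mem hD
  rw [← hA.2, ← Submodule.map_span] at h1
  obtain ⟨B, hB, hBD⟩ := h1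
  have h2 : D - B ∈ localDual m (saturation J m) := by
    rw [← Submodule.Quotient.eq]
    exact hBD.symm
  have h3 : evalAt m f B = 0 := by
    have : Submodule.span _ A ≤ LinearMap.ker (evalAt m f) := Submodule.span_le.mpr hf
    exact this hB
  have h4 := hs _ h2
  rwa [map_sub, h3, sub_zero] at h4

end Maximal

/-! ### Associated primes and local membership -/

section AssociatedPrimes

variable {A : Type*} [CommRing A] [IsNoetherianRing A] {I : Ideal A} {f : A}

/-- In a Noetherian ring such a `q` is itself of the form `(I : g)`, the annihilator of the coset of
`g`. -/
theorem mem_associatedPrimes_of_mem_minimalPrimes_colon {q : Ideal A}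
    (hq : q ∈ (Submodule.colon I {f}).minimalPrimes) : q ∈ associatedPrimes A (A ⧸ I) := by
  have hcolon : ∀ g : A, Submodule.colon (⊥ : Submodule A (A ⧸ I)) {Ideal.Quotient.mk I g} =
      Submodule.colon I {g} := by
    intro g
    ext r
    rw [Submodule.mem_colon_singleton, Submodule.mem_colon_singleton, Submodule.mem_bot,
      smul_eq_mul, ← Ideal.Quotient.eq_zero_iff_mem]
    rfl
  obtain ⟨g, rfl⟩ := Submodule.exists_eq_colon_of_mem_minimalPrimes hq
  exact isAssociatedPrime_iff.mpr ⟨hq.1.1, Ideal.Quotient.mk I g, (hcolon g).symm⟩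

theorem mem_of_forall_associatedPrimes
    (h : ∀ p ∈ associatedPrimes A (A ⧸ I), ∃ s, s ∉ p ∧ s * f ∈ I) : f ∈ I := by
  by_contra hf
  have hL : Submodule.colon I {f} ≠ ⊤ := fun h => hf <| by
    have h1 : (1 : A) ∈ Submodule.colon I {f} := h ▸ Submodule.mem_top
    simpa [Submodule.mem_colon_singleton] using h1
  obtain ⟨q, hq⟩ := Ideal.nonempty_minimalPrimes hL
  obtain ⟨s, hs, hsf⟩ := h q (mem_associatedPrimes_of_mem_minimalPrimes_colon hq)
  exact hs (hq.1.2 (Submodule.mem_colon_singleton.mpr hsf))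

/-- The hypothesis excludes minimal primes of `(I : f)` strictly inside `p`. Those other than `p`
are finitely many and not contained in `p`, so some `s ∉ p` lies in all of them; then `s p` lies in
the radical of `(I : f)`, and a power of `s p` in `(I : f)`. -/
theorem exists_mul_pow_mem_of_forall_lt {p : Ideal A} [hp : p.IsPrime]
    (h : ∀ q ∈ associatedPrimes A (A ⧸ I), q < p → ∃ s, s ∉ q ∧ s * f ∈ I) :
    ∃ s, s ∉ p ∧ ∃ k, ∀ g ∈ p ^ k, s * f * g ∈ I := by
  classical
  set L := Submodule.colon I {f}
  have hfin := Ideal.finite_minimalPrimes_of_isNoetherianRing A L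
  have hle : ∀ q ∈ L.minimalPrimes, q ≤ p → q = p := by
    intro q hq hqp
    by_contra hne
    obtain ⟨s, hs, hsf⟩ := h q (mem_associatedPrimes_of_mem_minimalPrimes_colon hq)
      (lt_of_le_of_ne hqp hne)
    exact hs (hq.1.2 (Submodule.mem_colon_singleton.mpr hsf))
  obtain ⟨s, hs, hsp⟩ : ∃ s, s ∈ (hfin.toFinset.erase p).inf id ∧ s ∉ p := by
    by_contra! hc
    obtain ⟨q, hq, hqp⟩ := (Ideal.IsPrime.inf_le' hp).mp hc
    rw [Finset.mem_erase, Set.Finite.mem_toFinset] at hq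
    exact hq.1 (hle q hq.2 hqp)
  have hrad : Ideal.span {s} * p ≤ L.radical := by
    rw [← Ideal.sInf_minimalPrimes]
    refine le_sInf fun q hq => ?_
    by_cases hqp : q = p
    · exact hqp ▸ Ideal.mul_le_right
    · refine Ideal.mul_le_left.trans ((Ideal.span_singleton_le_iff_mem _).mpr ?_)
      exact (Finset.inf_le (f := id) (Finset.mem_erase.mpr ⟨hqp, hfin.mem_toFinset.mpr hq⟩) :
        _ ≤ q) hs
  obtain ⟨k, hk⟩ := L.exists_radical_pow_le_of_fg L.radical.fg_of_isNoetherianRing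
  refine ⟨s ^ k, fun hsk => hsp (hp.mem_of_pow_mem k hsk), k, fun g hg => ?_⟩
  have h1 : s ^ k * g ∈ (Ideal.span {s} * p) ^ k := by
    rw [mul_pow]
    exact Ideal.mul_mem_mul (Ideal.pow_mem_pow (Ideal.mem_span_singleton_self s) k) hg
  have h2 := Submodule.mem_colon_singleton.mp (hk (Ideal.pow_right_mono hrad k h1))
  rw [smul_eq_mul] at h2
  convert h2 using 1
  ring

end AssociatedPrimes

theorem algebraMap_mem_localize_iff {A : Type*} [CommRing A] {I p : Ideal A} {f : A} [p.IsPrime] :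
    algebraMap A (Localization.AtPrime p) f ∈ I.map (algebraMap A (Localization.AtPrime p)) ↔
      ∃ s, s ∉ p ∧ s * f ∈ I := by
  rw [IsLocalization.algebraMap_mem_map_algebraMap_iff p.primeCompl]
  rfl

/-! ### The localization `R → K(t)[y]` -/

section Extension

variable {K : Type*} [Field K] {n : ℕ} (z : ParameterSystem K n) (T : Finset (Fin n))

/-- The isomorphism `R ≃ K[t][y]`. -/
noncomputable def splitEquiv : MvPolynomial (Fin n) K ≃ₐ[K]
    MvPolynomial {j // j ∉ T} (MvPolynomial {i // i ∈ T} K) :=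
  z.equiv.symm.trans <| (renameEquiv K
    ((Equiv.sumComm _ _).trans (Equiv.sumCompl (· ∈ T))).symm).trans <| sumAlgEquiv K _ _

theorem toRat_eq_map_splitEquiv (f : MvPolynomial (Fin n) K) :
    toRat z T f = map (algebraMap _ (RatField K T)) (splitEquiv z T f) := by
  have h : (aeval fun j => if h : j ∈ T
      then C (algebraMap (MvPolynomial {i // i ∈ T} K) (RatField K T) (X ⟨j, h⟩))
      else X ⟨j, h⟩ : MvPolynomial (Fin n) K →ₐ[K] RatRing K T) =
      (mapAlgHom (IsScalarTower.toAlgHom K (MvPolynomial {i // i ∈ T} K) (RatField K T))).comp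
        (((renameEquiv K ((Equiv.sumComm _ _).trans (Equiv.sumCompl (· ∈ T))).symm).trans <|
          sumAlgEquiv K _ _) : MvPolynomial (Fin n) K →ₐ[K] _) := by
    apply MvPolynomial.algHom_ext
    intro j
    by_cases hj : j ∈ T
    · simp [hj, Equiv.sumCompl_symm_apply_of_pos]
    · simp [hj, Equiv.sumCompl_symm_apply_of_neg]
  exact DFunLike.congr_fun h (z.equiv.symm f)

theorem splitEquiv_symm_C (q : MvPolynomial {i // i ∈ T} K) :
    (splitEquiv z T).symm (C q) = aeval (fun i : {i // i ∈ T} => z.param i) q := by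
  have h : (splitEquiv z T).symm.toAlgHom.comp
      (IsScalarTower.toAlgHom K (MvPolynomial {i // i ∈ T} K) _) =
      aeval (fun i : {i // i ∈ T} => z.param i) := by
    apply MvPolynomial.algHom_ext
    intro j
    simp [splitEquiv, algebraMap_eq, ParameterSystem.equiv]
  exact DFunLike.congr_fun h q

/-- The image in `R` of the nonzero elements of `K[t]`. -/
noncomputable def denominators : Submonoid (MvPolynomial (Fin n) K) :=
  (nonZeroDivisors (MvPolynomial {i // i ∈ T} K)).map
    (aeval fun i : {i // i ∈ T} => z.param i : MvPolynomial {i // i ∈ T} K →ₐ[K] _)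

/-- Under `R ≃ K[t][y]` the denominators become the nonzero constants of `K[t]`, and inverting these
replaces the coefficient ring by its fraction field. -/
theorem isLocalization_toRat :
    letI := (toRat z T).toRingHom.toAlgebra
    IsLocalization (denominators z T) (RatRing K T) := by
  let _ := MvPolynomial.algebraMvPolynomial (σ := {j // j ∉ T})
    (R := MvPolynomial {i // i ∈ T} K) (S := RatField K T)
  have h := IsLocalization.isLocalization_of_base_ringEquiv
    ((nonZeroDivisors (MvPolynomial {i // i ∈ T} K)).map (C (σ := {j // j ∉ T})))
    (RatRing K T) (splitEquiv z T).symm.toRingEquiv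
  have h1 : (toRat z T).toRingHom = (algebraMap
      (MvPolynomial {j // j ∉ T} (MvPolynomial {i // i ∈ T} K)) (RatRing K T)).comp
        (splitEquiv z T).symm.toRingEquiv.symm.toRingHom :=
    RingHom.ext (toRat_eq_map_splitEquiv z T)
  rw [← h1] at h
  convert h using 1
  rw [denominators]
  ext x
  simp only [Submonoid.mem_map, exists_exists_and_eq_and, ← splitEquiv_symm_C]
  rfl

variable {z T}

theorem mem_denominators_iff {x : MvPolynomial (Fin n) K} :
    x ∈ denominators z T ↔ ∃ q : MvPolynomial {i // i ∈ T} K, q ≠ 0 ∧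
      aeval (fun i : {i // i ∈ T} => z.param i) q = x := by
  simp [denominators, Submonoid.mem_map]

theorem isUnit_toRat {x : MvPolynomial (Fin n) K} (hx : x ∈ denominators z T) :
    IsUnit (toRat z T x) :=
  let _ := (toRat z T).toRingHom.toAlgebra
  haveI := isLocalization_toRat z T
  IsLocalization.map_units (RatRing K T) (⟨x, hx⟩ : denominators z T)

theorem exists_mul_toRat_eq (g : RatRing K T) :
    ∃ x ∈ denominators z T, ∃ f, g * toRat z T x = toRat z T f := by
  let _ := (toRat z T).toRingHom.toAlgebra
  have := isLocalization_toRat z T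
  obtain ⟨⟨f, x⟩, h⟩ := IsLocalization.surj (denominators z T) g
  exact ⟨x, x.2, f, h⟩

theorem toRat_mem_extend_iff {I : Ideal (MvPolynomial (Fin n) K)} {f : MvPolynomial (Fin n) K} :
    toRat z T f ∈ extend z T I ↔ ∃ x ∈ denominators z T, x * f ∈ I := by
  let _ := (toRat z T).toRingHom.toAlgebra
  have := isLocalization_toRat z T
  exact IsLocalization.algebraMap_mem_map_algebraMap_iff (denominators z T) (RatRing K T) I f

variable {p : Ideal (MvPolynomial (Fin n) K)}

theorem mk_aeval_param (q : MvPolynomial {i // i ∈ T} K) :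
    Ideal.Quotient.mk p (aeval (fun i : {i // i ∈ T} => z.param i) q) =
      aeval (fun i : {i // i ∈ T} => Ideal.Quotient.mk p (z.param i)) q := by
  rw [← Ideal.Quotient.mkₐ_eq_mk K, ← comp_aeval_apply]

theorem notMem_of_mem_denominators
    (h : IsTranscendenceBasis K (fun i : {i // i ∈ T} => Ideal.Quotient.mk p (z.param i)))
    {x : MvPolynomial (Fin n) K} (hx : x ∈ denominators z T) : x ∉ p := by
  obtain ⟨q, hq, rfl⟩ := mem_denominators_iff.mp hx
  intro hqp
  refine hq ((injective_iff_map_eq_zero _).mp h.1 q ?_)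
  rwa [← Ideal.Quotient.eq_zero_iff_mem, mk_aeval_param] at hqp

theorem toRat_mem_extend_prime_iff [hp : p.IsPrime]
    (h : IsTranscendenceBasis K (fun i : {i // i ∈ T} => Ideal.Quotient.mk p (z.param i)))
    {f : MvPolynomial (Fin n) K} : toRat z T f ∈ extend z T p ↔ f ∈ p := by
  rw [toRat_mem_extend_iff]
  refine ⟨fun ⟨x, hx, hxf⟩ => (hp.mem_or_mem hxf).resolve_left (notMem_of_mem_denominators h hx),
    fun hf => ⟨1, one_mem _, p.mul_mem_left 1 hf⟩⟩

/-- As `R ⧸ p` is algebraic over `K[t]`, each nonzero coset divides a nonzero polynomial in `t`,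
which is a unit in `K(t)[y]`. -/
theorem isMaximal_extend [hp : p.IsPrime]
    (h : IsTranscendenceBasis K (fun i : {i // i ∈ T} => Ideal.Quotient.mk p (z.param i))) :
    (extend z T p).IsMaximal := by
  rw [Ideal.isMaximal_iff]
  constructor
  · rw [← map_one (toRat z T), toRat_mem_extend_prime_iff h]
    exact hp.one_notMem
  intro J g hJ hg hgJ
  obtain ⟨x, hx, f, hf⟩ := exists_mul_toRat_eq (z := z) g
  have hfp : f ∉ p := by
    rw [← toRat_mem_extend_prime_iff h, ← hf]
    exact fun hmem => hg ((Ideal.mul_unit_mem_iff_mem _ (isUnit_toRat hx)).mp hmem)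
  have hfJ : toRat z T f ∈ J := hf ▸ J.mul_mem_right _ hgJ
  have halg := h.isAlgebraic
  have hne := Ideal.comap_ne_bot_of_algebraic_mem
    (I := Ideal.span {Ideal.Quotient.mk p f})
    (mt Ideal.Quotient.eq_zero_iff_mem.mp hfp) (Ideal.mem_span_singleton_self _)
    (halg.isAlgebraic (Ideal.Quotient.mk p f))
  obtain ⟨⟨b, hb⟩, hbf, hb0⟩ := Submodule.exists_mem_ne_zero_of_ne_bot hne
  obtain ⟨q, rfl⟩ : ∃ q, aeval (fun i : {i // i ∈ T} => Ideal.Quotient.mk p (z.param i)) q = b := by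
    rwa [Algebra.adjoin_range_eq_range_aeval] at hb
  have hq : q ≠ 0 := by
    rintro rfl
    exact hb0 (Subtype.ext (map_zero _))
  obtain ⟨c, hc⟩ := Ideal.mem_span_singleton'.mp (Ideal.mem_comap.mp hbf)
  obtain ⟨c, rfl⟩ := Ideal.Quotient.mk_surjective c
  set x := aeval (fun i : {i // i ∈ T} => z.param i) q with hx'
  have hxp : x - c * f ∈ p := by
    rw [← Ideal.Quotient.eq_zero_iff_mem, map_sub, map_mul, hc, hx', mk_aeval_param, sub_eq_zero]
    rfl
  have hxJ : toRat z T x ∈ J := by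
    rw [← sub_add_cancel x (c * f), map_add, map_mul (toRat z T)]
    exact J.add_mem (hJ (Ideal.mem_map_of_mem _ hxp)) (J.mul_mem_left _ hfJ)
  exact (Ideal.eq_top_iff_one J).mp
    (J.eq_top_of_isUnit_mem hxJ (isUnit_toRat (mem_denominators_iff.mpr ⟨q, hq, rfl⟩)))

end Extension

/-! ### Recovery of the localizations and of the ideal -/

section Recovery

variable {K : Type*} [Field K] [CharZero K] {n : ℕ} {I p : Ideal (MvPolynomial (Fin n) K)}
  {f : MvPolynomial (Fin n) K}

instance (T : Finset (Fin n)) : CharZero (RatField K T) :=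
  charZero_of_injective_algebraMap (algebraMap K (RatField K T)).injective

omit [CharZero K] in
theorem PrimeData.annihilates_of_mul_mem [p.IsPrime] (d : PrimeData p) (hd : d.Describes I)
    {s : MvPolynomial (Fin n) K} (hs : s ∉ p) (hsf : s * f ∈ I) : d.Annihilates f := by
  have := isMaximal_extend d.free
  intro D hD
  refine evalAt_eq_zero_of_mul_mem (s := toRat d.z d.T s)
    (mt (toRat_mem_extend_prime_iff d.free).mp hs) ?_ (hd.1 hD)
  rw [← map_mul]
  exact Ideal.mem_map_of_mem _ hsf

/-- The inductive step: membership at the smaller associated primes puts `f` locally in the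
saturation, which is what makes testing modulo its dual space sufficient. -/
theorem PrimeData.exists_mul_mem_of_annihilates [p.IsPrime] (d : PrimeData p)
    (hd : d.Describes I) (hf : d.Annihilates f)
    (h : ∀ q ∈ Ass I, q < p → ∃ s, s ∉ q ∧ s * f ∈ I) : ∃ s, s ∉ p ∧ s * f ∈ I := by
  have := isMaximal_extend d.free
  obtain ⟨s, hs, k, hk⟩ := exists_mul_pow_mem_of_forall_lt h
  have hsat : toRat d.z d.T s * toRat d.z d.T f ∈
      saturation (extend d.z d.T I) (extend d.z d.T p) := by
    refine Submodule.mem_iSup_of_mem k (Submodule.mem_colon.mpr fun g hg => ?_)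
    rw [SetLike.mem_coe, extend, ← Ideal.map_pow] at hg
    rw [smul_eq_mul, ← map_mul]
    refine Submodule.span_induction (p := fun g _ => toRat d.z d.T (s * f) * g ∈
      extend d.z d.T I) ?_ ?_ ?_ ?_ hg
    · rintro _ ⟨g, hg, rfl⟩
      rw [← map_mul]
      exact Ideal.mem_map_of_mem _ (hk g hg)
    · simp
    · intro x y _ _ hx hy
      rw [mul_add]
      exact Ideal.add_mem _ hx hy
    · intro r x _ hx
      rw [smul_eq_mul, mul_left_comm]
      exact Ideal.mul_mem_left _ r hx
  obtain ⟨g, hg, hgf⟩ := exists_mul_mem_of_forall_evalAt_eq_zero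
    (m := extend d.z d.T p) (J := extend d.z d.T I) (f := toRat d.z d.T f) fun D hD =>
    SpansExcess.evalAt_eq_zero hd hf (fun E hE => evalAt_eq_zero_of_mul_mem
      (mt (toRat_mem_extend_prime_iff d.free).mp hs) hsat hE) hD
  -- Denominators are cleared twice: `x` brings `g` into `R` as `u`, and `y` below brings `u * f`
  -- into `I`. Neither leaves the complement of `p`.
  obtain ⟨x, hx, u, hu⟩ := exists_mul_toRat_eq (z := d.z) g
  have hup : u ∉ p := by
    rw [← toRat_mem_extend_prime_iff d.free, ← hu]
    exact fun hmem => hg ((Ideal.mul_unit_mem_iff_mem _ (isUnit_toRat hx)).mp hmem)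
  have hufI : toRat d.z d.T (u * f) ∈ extend d.z d.T I := by
    rw [map_mul, ← hu, mul_right_comm]
    exact Ideal.mul_mem_right _ _ hgf
  obtain ⟨y, hy, hyf⟩ := toRat_mem_extend_iff.mp hufI
  refine ⟨y * u, fun hyu => ?_, by rwa [mul_assoc]⟩
  exact (Ideal.IsPrime.mem_or_mem ‹_› hyu).elim (notMem_of_mem_denominators d.free hy) hup

variable (data : ∀ p : Ass I, PrimeData (p : Ideal (MvPolynomial (Fin n) K)))

/-- The converse is by induction along inclusion in the finite set `Ass I`. A general `J` is allowed
because the criterion on the right does not mention `J`; determinacy rests on this. -/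
theorem exists_mul_mem_iff_forall_annihilates {J : Ideal (MvPolynomial (Fin n) K)}
    (hJ : Ass J = Ass I) (hdata : ∀ p, (data p).Describes J) (p : Ass I) :
    (∃ s, s ∉ (p : Ideal (MvPolynomial (Fin n) K)) ∧ s * f ∈ J) ↔
      ∀ p' : Ass I, (p' : Ideal (MvPolynomial (Fin n) K)) ≤ p → (data p').Annihilates f := by
  constructor
  · rintro ⟨s, hs, hsf⟩ p' hp'
    exact (data p').annihilates_of_mul_mem (hdata p') (fun h => hs (hp' h)) hsf
  · have : Finite (Ass I) := associatedPrimes.finite _ _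
    induction p using WellFoundedLT.induction with
    | ind p ih =>
      intro h
      refine (data p).exists_mul_mem_of_annihilates (hdata p) (h p le_rfl) fun q hq hqp => ?_
      exact ih ⟨q, hJ ▸ hq⟩ hqp fun p' hp' => h p' (hp'.trans hqp.le)

theorem mem_iff_forall_annihilates {J : Ideal (MvPolynomial (Fin n) K)}
    (hJ : Ass J = Ass I) (hdata : ∀ p, (data p).Describes J) :
    f ∈ J ↔ ∀ p : Ass I, (data p).Annihilates f := by
  constructor
  · intro hf p
    exact (data p).annihilates_of_mul_mem (hdata p) (s := 1)
      (Ass.isPrime p).one_notMem (by rwa [one_mul])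
  · intro h
    refine mem_of_forall_associatedPrimes fun p hp => ?_
    exact (exists_mul_mem_iff_forall_annihilates data hJ hdata ⟨p, hJ ▸ hp⟩).mpr
      fun p' _ => h p'

end Recovery

end LocalDual

theorem mainTheorem1 {K : Type*} [Field K] [CharZero K] {n : ℕ}
    (I : Ideal (MvPolynomial (Fin n) K))
    (data : ∀ p : LocalDual.Ass I,
      LocalDual.PrimeData (p : Ideal (MvPolynomial (Fin n) K)))
    (hdata : ∀ p, (data p).Describes I) :
    (∀ J : Ideal (MvPolynomial (Fin n) K), LocalDual.Ass J = LocalDual.Ass I →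
      (∀ p, (data p).Describes J) → J = I) ∧
    (∀ (p : LocalDual.Ass I) (f : MvPolynomial (Fin n) K),
      algebraMap (MvPolynomial (Fin n) K)
          (Localization.AtPrime (p : Ideal (MvPolynomial (Fin n) K))) f ∈
          LocalDual.localize I (p : Ideal (MvPolynomial (Fin n) K)) ↔
        ∀ p' : LocalDual.Ass I, (p' : Ideal (MvPolynomial (Fin n) K)) ≤ p →
          (data p').Annihilates f) ∧
    (∀ f : MvPolynomial (Fin n) K,
      f ∈ I ↔ ∀ p : LocalDual.Ass I, (data p).Annihilates f) := by
  refine ⟨fun J hJ hdataJ => ?_, fun p f => ?_, fun f => ?_⟩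
  · ext f
    rw [LocalDual.mem_iff_forall_annihilates data hJ hdataJ,
      LocalDual.mem_iff_forall_annihilates data rfl hdata]
  · rw [LocalDual.algebraMap_mem_localize_iff]
    exact LocalDual.exists_mul_mem_iff_forall_annihilates data rfl hdata p
  · exact LocalDual.mem_iff_forall_annihilates data rfl hdata
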